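/- Let $m\ge 2$ and $n\ge 1$ be integers. Let $S^m\subset\mathbb R^{m+1}$ be the unit sphere with its uniform (normalised surface) probability measure, and equip $(S^m)^n$ with the product probability measure. For $i\in\{1,2\}$ let $h_i(z)=z_i$ be the $i$-th coordinate of $z=(z_1,\dots,z_{m+1})\in S^m$, let $\mathcal H_i=\sigma(h_i(x_1),\dots,h_i(x_n))$ be the $\sigma$-algebra on $(S^m)^n$ generated by the $i$-th coordinates of the $n$ points of $x=(x_1,\dots,x_n)$, and let $E_if=\mathbb E[f\mid\mathcal H_i]$ be the corresponding conditional expectation operator on the complex space $L^2((S^m)^n)$. Then for every $f\in L^2((S^m)^n)$ with $\int f=0$, \[ \|E_2E_1f\|_2\le \frac1m\,\|f\|_2 . \] -/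

import Mathlib

open MeasureTheory
open scoped ENNReal

/-- The unit sphere `S^m` in `ℝ^(m+1)`. -/
abbrev UnitSphere (m : ℕ) : Type :=
  Metric.sphere (0 : EuclideanSpace ℝ (Fin (m + 1))) 1

/-- The uniform (normalised surface) probability measure on `S^m`. -/
noncomputable def sphereUniform (m : ℕ) : Measure (UnitSphere m) :=
  ((volume : Measure (EuclideanSpace ℝ (Fin (m + 1)))).toSphere Set.univ)⁻¹ •
    (volume : Measure (EuclideanSpace ℝ (Fin (m + 1)))).toSphere

instance sphereUniform_isProbabilityMeasure (m : ℕ) :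
    IsProbabilityMeasure (sphereUniform m) := by
  have : NeZero (volume : Measure (EuclideanSpace ℝ (Fin (m + 1)))).toSphere :=
    ⟨Measure.toSphere_ne_zero _⟩
  unfold sphereUniform
  infer_instance

/-- The product probability measure on `(S^m)^n`: `n` independent uniform points. -/
noncomputable def spherePowUniform (m n : ℕ) : Measure (Fin n → UnitSphere m) :=
  Measure.pi fun _ => sphereUniform m

instance spherePowUniform_isProbabilityMeasure (m n : ℕ) :
    IsProbabilityMeasure (spherePowUniform m n) := by
  unfold spherePowUniform
  infer_instance

/-- The vector of the `i`-th coordinates (heights) of the `n` points (`i` counted from `0`). -/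
def heights (m n : ℕ) (i : Fin (m + 1)) (x : Fin n → UnitSphere m) : Fin n → ℝ :=
  fun j => (x j : EuclideanSpace ℝ (Fin (m + 1))) i

theorem measurable_heights (m n : ℕ) (i : Fin (m + 1)) : Measurable (heights m n i) := by
  unfold heights
  fun_prop

/-- The σ-algebra on `(S^m)^n` generated by the `i`-th heights of the `n` points. -/
abbrev heightSigma (m n : ℕ) (i : Fin (m + 1)) : MeasurableSpace (Fin n → UnitSphere m) :=
  MeasurableSpace.comap (heights m n i) inferInstance

theorem heightSigma_le (m n : ℕ) (i : Fin (m + 1)) :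
    heightSigma m n i ≤ (inferInstance : MeasurableSpace (Fin n → UnitSphere m)) :=
  (measurable_heights m n i).comap_le

/-- Conditional expectation of `f` given the `i`-th heights of the `n` points. -/
noncomputable def heightCondExp (m n : ℕ) (i : Fin (m + 1))
    (f : (Fin n → UnitSphere m) → ℂ) : (Fin n → UnitSphere m) → ℂ :=
  condExp (heightSigma m n i) (spherePowUniform m n) f

/-!
Let `μ_k` be the `k`-th moment of a coordinate of a uniform point of `S^(m-1)`. On `S^m`, the
points with `x_j = t` form a sphere of radius `√(1 - t²)`, so `E[x_i^k | x_j = t]` is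
`μ_k (1 - t²)^(k/2)`. For odd `k` this vanishes, and for even `k` it is a polynomial in `t` of
degree `k` with leading coefficient `± μ_k`. Hence the orthogonal polynomials of one coordinate
diagonalise the correlation of two coordinates, with coefficients `± μ_k`, and `|μ_k| ≤ μ_2 = 1/m`
for `k ≠ 0`. Products of these polynomials diagonalise the correlation of `n` independent copies,
with products of the coefficients, so the `n` copies have maximal correlation at most `1/m` too.
Finally `‖E_j g‖² = ⟪g, E_j g⟫` turns the bound on correlations into the bound on norms.
-/

section BiorthogonalFamilies

open scoped InnerProductSpace

variable (𝕜 : Type*) [RCLike 𝕜] {ι H : Type*} [NormedAddCommGroup H] [InnerProductSpace 𝕜 H]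

/-- Two families of vectors, each of them orthogonal, which are also orthogonal to each other
except for vectors with the same index. The vectors need not be normalised and may vanish. -/
structure IsBiorthogonal (e e' : ι → H) : Prop where
  left : Pairwise fun a b ↦ ⟪e a, e b⟫_𝕜 = 0
  right : Pairwise fun a b ↦ ⟪e' a, e' b⟫_𝕜 = 0
  cross : Pairwise fun a b ↦ ⟪e a, e' b⟫_𝕜 = 0

variable {𝕜}

theorem norm_sum_sq_of_pairwise_inner_eq_zero {e : ι → H} (he : Pairwise fun a b ↦ ⟪e a, e b⟫_𝕜 = 0)
    (s : Finset ι) : ‖∑ a ∈ s, e a‖ ^ 2 = ∑ a ∈ s, ‖e a‖ ^ 2 := by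
  have hself : ∀ a ∈ s, ∑ b ∈ s, ⟪e a, e b⟫_𝕜 = ⟪e a, e a⟫_𝕜 := fun a ha ↦
    Finset.sum_eq_single_of_mem a ha fun b _ hb ↦ he hb.symm
  rw [← inner_self_eq_norm_sq (𝕜 := 𝕜), sum_inner]
  simp only [inner_sum, Finset.sum_congr rfl hself, map_sum, inner_self_eq_norm_sq]

namespace IsBiorthogonal

variable {e e' : ι → H} {κ : ℝ}

theorem comp_injective {ι' : Type*} (h : IsBiorthogonal 𝕜 e e') {u : ι' → ι}
    (hu : Function.Injective u) : IsBiorthogonal 𝕜 (e ∘ u) (e' ∘ u) where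
  left _ _ hab := h.left (hu.ne hab)
  right _ _ hab := h.right (hu.ne hab)
  cross _ _ hab := h.cross (hu.ne hab)

theorem smul (h : IsBiorthogonal 𝕜 e e') (x y : ι → 𝕜) :
    IsBiorthogonal 𝕜 (fun a ↦ x a • e a) (fun a ↦ y a • e' a) where
  left _ _ hab := by simp only [inner_smul_left, inner_smul_right, h.left hab, mul_zero]
  right _ _ hab := by simp only [inner_smul_left, inner_smul_right, h.right hab, mul_zero]
  cross _ _ hab := by simp only [inner_smul_left, inner_smul_right, h.cross hab, mul_zero]

theorem norm_inner_sum_le (h : IsBiorthogonal 𝕜 e e')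
    (hκ : ∀ a, ‖⟪e a, e' a⟫_𝕜‖ ≤ κ * (‖e a‖ * ‖e' a‖)) (hκ₀ : 0 ≤ κ) (s : Finset ι) :
    ‖⟪∑ a ∈ s, e a, ∑ a ∈ s, e' a⟫_𝕜‖ ≤ κ * (‖∑ a ∈ s, e a‖ * ‖∑ a ∈ s, e' a‖) := by
  have hdiag : ∀ b ∈ s, ∑ a ∈ s, ⟪e a, e' b⟫_𝕜 = ⟪e b, e' b⟫_𝕜 := fun b hb ↦
    Finset.sum_eq_single_of_mem b hb fun a _ ha ↦ h.cross ha
  calc ‖⟪∑ a ∈ s, e a, ∑ a ∈ s, e' a⟫_𝕜‖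
      = ‖∑ a ∈ s, ⟪e a, e' a⟫_𝕜‖ := by
        simp only [sum_inner, inner_sum, Finset.sum_congr rfl hdiag]
    _ ≤ ∑ a ∈ s, κ * (‖e a‖ * ‖e' a‖) := norm_sum_le_of_le _ fun a _ ↦ hκ a
    _ = κ * ∑ a ∈ s, ‖e a‖ * ‖e' a‖ := (Finset.mul_sum _ _ _).symm
    _ ≤ κ * (√(∑ a ∈ s, ‖e a‖ ^ 2) * √(∑ a ∈ s, ‖e' a‖ ^ 2)) := by
        gcongr
        exact Real.sum_mul_le_sqrt_mul_sqrt _ _ _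
    _ = κ * (‖∑ a ∈ s, e a‖ * ‖∑ a ∈ s, e' a‖) := by
        rw [← norm_sum_sq_of_pairwise_inner_eq_zero h.left,
          ← norm_sum_sq_of_pairwise_inner_eq_zero h.right, Real.sqrt_sq (norm_nonneg _),
          Real.sqrt_sq (norm_nonneg _)]

theorem norm_inner_le_of_mem_span (h : IsBiorthogonal 𝕜 e e')
    (hκ : ∀ a, ‖⟪e a, e' a⟫_𝕜‖ ≤ κ * (‖e a‖ * ‖e' a‖)) (hκ₀ : 0 ≤ κ) {g g' : H}
    (hg : g ∈ Submodule.span 𝕜 (Set.range e)) (hg' : g' ∈ Submodule.span 𝕜 (Set.range e')) :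
    ‖⟪g, g'⟫_𝕜‖ ≤ κ * (‖g‖ * ‖g'‖) := by
  classical
  obtain ⟨x, rfl⟩ := Finsupp.mem_span_range_iff_exists_finsupp.1 hg
  obtain ⟨y, rfl⟩ := Finsupp.mem_span_range_iff_exists_finsupp.1 hg'
  rw [x.sum_of_support_subset (s := x.support ∪ y.support) Finset.subset_union_left _ (by simp),
    y.sum_of_support_subset (s := x.support ∪ y.support) Finset.subset_union_right _ (by simp)]
  refine (h.smul x y).norm_inner_sum_le (fun a ↦ ?_) hκ₀ _
  calc ‖⟪x a • e a, y a • e' a⟫_𝕜‖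
      = ‖x a‖ * ‖y a‖ * ‖⟪e a, e' a⟫_𝕜‖ := by
        rw [inner_smul_left, inner_smul_right, norm_mul, norm_mul, RCLike.norm_conj, mul_assoc]
    _ ≤ ‖x a‖ * ‖y a‖ * (κ * (‖e a‖ * ‖e' a‖)) := by gcongr; exact hκ a
    _ = κ * (‖x a • e a‖ * ‖y a • e' a‖) := by rw [norm_smul, norm_smul]; ring

theorem norm_inner_le_of_mem_topologicalClosure (h : IsBiorthogonal 𝕜 e e')
    (hκ : ∀ a, ‖⟪e a, e' a⟫_𝕜‖ ≤ κ * (‖e a‖ * ‖e' a‖)) (hκ₀ : 0 ≤ κ) {g g' : H}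
    (hg : g ∈ (Submodule.span 𝕜 (Set.range e)).topologicalClosure)
    (hg' : g' ∈ (Submodule.span 𝕜 (Set.range e')).topologicalClosure) :
    ‖⟪g, g'⟫_𝕜‖ ≤ κ * (‖g‖ * ‖g'‖) := by
  have hclosed : IsClosed {z : H × H | ‖⟪z.1, z.2⟫_𝕜‖ ≤ κ * (‖z.1‖ * ‖z.2‖)} :=
    isClosed_le (by fun_prop) (by fun_prop)
  refine closure_minimal (s := (Submodule.span 𝕜 (Set.range e) : Set H) ×ˢ
    (Submodule.span 𝕜 (Set.range e') : Set H)) ?_ hclosed (a := (g, g')) ?_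
  · exact fun z hz ↦ h.norm_inner_le_of_mem_span hκ hκ₀ hz.1 hz.2
  · rw [closure_prod_eq]
    exact ⟨hg, hg'⟩

end IsBiorthogonal

theorem starProjection_orthogonal_mem_topologicalClosure_span_ne {e : ι → H}
    (he : Pairwise fun a b ↦ ⟪e a, e b⟫_𝕜 = 0) (a₀ : ι) {g : H}
    (hg : g ∈ (Submodule.span 𝕜 (Set.range e)).topologicalClosure) :
    (𝕜 ∙ e a₀)ᗮ.starProjection g ∈
      (Submodule.span 𝕜 (Set.range fun a : {a // a ≠ a₀} ↦ e a)).topologicalClosure := by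
  refine map_mem_closure (ContinuousLinearMap.continuous _) hg fun f hf ↦ ?_
  suffices Submodule.span 𝕜 (Set.range e) ≤
      (Submodule.span 𝕜 (Set.range fun a : {a // a ≠ a₀} ↦ e a)).comap
        ((𝕜 ∙ e a₀)ᗮ.starProjection : H →ₗ[𝕜] H) from this hf
  rw [Submodule.span_le]
  rintro _ ⟨a, rfl⟩
  rcases eq_or_ne a a₀ with rfl | ha
  · have : (𝕜 ∙ e a)ᗮ.starProjection (e a) = 0 := by
      rw [Submodule.starProjection_apply_eq_zero_iff, Submodule.orthogonal_orthogonal]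
      exact Submodule.mem_span_singleton_self _
    simp [this]
  · have : (𝕜 ∙ e a₀)ᗮ.starProjection (e a) = e a :=
      Submodule.starProjection_eq_self_iff.2 (Submodule.mem_orthogonal_singleton_iff_inner_right.2
        (he ha.symm))
    have hmem : e a ∈ Submodule.span 𝕜 (Set.range fun a : {a // a ≠ a₀} ↦ e a) :=
      Submodule.subset_span ⟨⟨a, ha⟩, rfl⟩
    simpa [this] using hmem

/-- A vector shared by the two families has correlation `1` with itself, so it has to be split off
from one of the two vectors; projecting the other one onto its orthogonal complement is free. -/
theorem IsBiorthogonal.norm_inner_le_of_inner_eq_zero {e e' : ι → H} {κ : ℝ} {a₀ : ι}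
    (h : IsBiorthogonal 𝕜 e e') (h₀ : e a₀ = e' a₀)
    (hκ : ∀ a ≠ a₀, ‖⟪e a, e' a⟫_𝕜‖ ≤ κ * (‖e a‖ * ‖e' a‖)) (hκ₀ : 0 ≤ κ) {g g' : H}
    (hg : g ∈ (Submodule.span 𝕜 (Set.range e)).topologicalClosure)
    (hg' : g' ∈ (Submodule.span 𝕜 (Set.range e')).topologicalClosure)
    (hg₀ : ⟪e a₀, g⟫_𝕜 = 0) :
    ‖⟪g, g'⟫_𝕜‖ ≤ κ * (‖g‖ * ‖g'‖) := by
  set Q := (𝕜 ∙ e a₀)ᗮ.starProjection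
  have hQg : Q g = g := Submodule.starProjection_eq_self_iff.2
    (Submodule.mem_orthogonal_singleton_iff_inner_right.2 hg₀)
  have hmem := hQg ▸ starProjection_orthogonal_mem_topologicalClosure_span_ne h.left a₀ hg
  have hmem' : Q g' ∈ (Submodule.span 𝕜
      (Set.range fun a : {a // a ≠ a₀} ↦ e' a)).topologicalClosure := by
    simpa only [Q, h₀] using
      starProjection_orthogonal_mem_topologicalClosure_span_ne h.right a₀ hg'
  calc ‖⟪g, g'⟫_𝕜‖ = ‖⟪g, Q g'⟫_𝕜‖ := by
        rw [← Submodule.inner_starProjection_left_eq_right, hQg]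
    _ ≤ κ * (‖g‖ * ‖Q g'‖) :=
        (h.comp_injective Subtype.val_injective).norm_inner_le_of_mem_topologicalClosure
          (fun a ↦ hκ a a.2) hκ₀ hmem hmem'
    _ ≤ κ * (‖g‖ * ‖g'‖) := by
        gcongr
        exact Submodule.norm_starProjection_apply_le _ _

end BiorthogonalFamilies

section PolynomialRegression

open Polynomial
open scoped InnerProductSpace

variable {H : Type*} [NormedAddCommGroup H] [InnerProductSpace ℝ H]

/-- `X ^ k`, embedded through `Φ`, is represented on the range of `Ψ` by a polynomial of degree at
most `k` whose coefficient of degree `k` is `c`. If `Φ p = p(U)` and `Ψ q = q(V)` for random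
variables `U` and `V`, this says that `𝔼[U ^ k | V]` is a polynomial in `V` of degree at most `k`
with leading coefficient `c`. -/
def HasRegressionCoeff (Φ Ψ : ℝ[X] →ₗ[ℝ] H) (k : ℕ) (c : ℝ) : Prop :=
  ∃ T : ℝ[X], T.natDegree ≤ k ∧ T.coeff k = c ∧ ∀ q, ⟪Φ (X ^ k), Ψ q⟫_ℝ = ⟪Ψ T, Ψ q⟫_ℝ

theorem exists_monic_sequence_inner_eq_zero (Ψ : ℝ[X] →ₗ[ℝ] H) :
    ∃ S : Polynomial.Sequence ℝ, (∀ k, (S k).Monic) ∧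
      ∀ k, ∀ r ∈ degreeLT ℝ k, ⟪Ψ r, Ψ (S k)⟫_ℝ = 0 := by
  have hproj : ∀ k, ∃ q ∈ degreeLT ℝ k, ∀ r ∈ degreeLT ℝ k, ⟪Ψ r, Ψ (X ^ k - q)⟫_ℝ = 0 := by
    intro k
    let V := (degreeLT ℝ k).map Ψ
    have : FiniteDimensional ℝ (degreeLT ℝ k) := Module.Finite.equiv (degreeLTEquiv ℝ k).symm
    have : FiniteDimensional ℝ V := inferInstance
    obtain ⟨q, hq, hqV⟩ : V.starProjection (Ψ (X ^ k)) ∈ V := Submodule.starProjection_apply_mem _ _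
    refine ⟨q, hq, fun r hr ↦ ?_⟩
    rw [map_sub, hqV]
    exact (Submodule.mem_orthogonal _ _).1 (V.sub_starProjection_mem_orthogonal (Ψ (X ^ k))) _
      (Submodule.mem_map_of_mem hr)
  choose q hq horth using hproj
  have hdeg : ∀ k, (q k).degree < (X ^ k : ℝ[X]).degree := fun k ↦ by
    rw [degree_X_pow]
    exact mem_degreeLT.1 (hq k)
  have hsub : ∀ k : ℕ, (X ^ k - q k).degree = (k : WithBot ℕ) := fun k ↦ by
    rw [degree_sub_eq_left_of_degree_lt (hdeg k), degree_X_pow]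
  exact ⟨⟨fun k ↦ X ^ k - q k, hsub⟩, fun k ↦ (monic_X_pow k).sub_of_left (hdeg k), horth⟩

theorem inner_map_eq_coeff_mul_norm_sq {Ψ : ℝ[X] →ₗ[ℝ] H} {p q : ℝ[X]} {k : ℕ} (hp : p.Monic)
    (hpk : p.natDegree = k) (horth : ∀ r ∈ degreeLT ℝ k, ⟪Ψ r, Ψ p⟫_ℝ = 0) (hq : q.natDegree ≤ k) :
    ⟪Ψ q, Ψ p⟫_ℝ = q.coeff k * ‖Ψ p‖ ^ 2 := by
  have hlt : q - q.coeff k • p ∈ degreeLT ℝ k := by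
    rw [mem_degreeLT, degree_lt_iff_coeff_zero]
    intro l hl
    rcases hl.eq_or_lt with rfl | hl
    · simp [← hpk, hp.coeff_natDegree]
    · simp [coeff_eq_zero_of_natDegree_lt (hq.trans_lt hl),
        coeff_eq_zero_of_natDegree_lt (hpk.trans_lt hl)]
  have := horth _ hlt
  rwa [map_sub, map_smul, inner_sub_left, real_inner_smul_left, real_inner_self_eq_norm_sq,
    sub_eq_zero] at this

theorem inner_map_map_eq_coeff_mul {Φ Ψ : ℝ[X] →ₗ[ℝ] H} {c : ℕ → ℝ}
    (hreg : ∀ k, HasRegressionCoeff Φ Ψ k (c k)) {p q : ℝ[X]} {k : ℕ} (hp : p.Monic)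
    (hpk : p.natDegree = k) (horth : ∀ r ∈ degreeLT ℝ k, ⟪Ψ r, Ψ p⟫_ℝ = 0) (hq : q.natDegree ≤ k) :
    ⟪Φ q, Ψ p⟫_ℝ = q.coeff k * (c k * ‖Ψ p‖ ^ 2) := by
  have hmonomial : ∀ l ≤ k, ⟪Φ (X ^ l), Ψ p⟫_ℝ = if l = k then c k * ‖Ψ p‖ ^ 2 else 0 := by
    intro l hl
    obtain ⟨T, hT, hTc, hΦ⟩ := hreg l
    rw [hΦ, inner_map_eq_coeff_mul_norm_sq hp hpk horth (hT.trans hl)]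
    split_ifs with h
    · rw [← h, hTc]
    · rw [coeff_eq_zero_of_natDegree_lt (hT.trans_lt (hl.lt_of_ne h)), zero_mul]
  conv_lhs => rw [q.as_sum_range_C_mul_X_pow' (Nat.lt_succ_of_le hq)]
  simp only [← smul_eq_C_mul, map_sum, map_smul, sum_inner, real_inner_smul_left]
  rw [Finset.sum_eq_single_of_mem k (Finset.self_mem_range_succ k), hmonomial k le_rfl, if_pos rfl]
  intro l hl hlk
  rw [hmonomial l (Nat.lt_succ_iff.1 (Finset.mem_range.1 hl)), if_neg hlk, mul_zero]

/-- The polynomials which are orthogonal with respect to `Ψ` diagonalise the correlation: testing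
`Φ q` against `Ψ (S k)` only sees the coefficient of degree `k` when `deg q ≤ k`, and the symmetry
of the correlation takes care of the case `deg q > k`. -/
theorem exists_sequence_isBiorthogonal {Φ Ψ : ℝ[X] →ₗ[ℝ] H} {c : ℕ → ℝ}
    (hself : ∀ p q, ⟪Φ p, Φ q⟫_ℝ = ⟪Ψ p, Ψ q⟫_ℝ) (hsymm : ∀ p q, ⟪Φ p, Ψ q⟫_ℝ = ⟪Φ q, Ψ p⟫_ℝ)
    (hreg : ∀ k, HasRegressionCoeff Φ Ψ k (c k)) :
    ∃ S : Polynomial.Sequence ℝ, S 0 = 1 ∧ IsBiorthogonal ℝ (fun k ↦ Φ (S k)) (fun k ↦ Ψ (S k)) ∧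
      ∀ k, ‖⟪Φ (S k), Ψ (S k)⟫_ℝ‖ = |c k| * (‖Φ (S k)‖ * ‖Ψ (S k)‖) := by
  obtain ⟨S, hmonic, horth⟩ := exists_monic_sequence_inner_eq_zero Ψ
  have hcross : ∀ k, ∀ q : ℝ[X], q.natDegree ≤ k →
      ⟪Φ q, Ψ (S k)⟫_ℝ = q.coeff k * (c k * ‖Ψ (S k)‖ ^ 2) := fun k q ↦
    inner_map_map_eq_coeff_mul hreg (hmonic k) (S.natDegree_eq k) (horth k)
  have hmem : ∀ {k l}, k < l → S k ∈ degreeLT ℝ l := fun h ↦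
    mem_degreeLT.2 (by rw [S.degree_eq]; exact_mod_cast h)
  have hright : Pairwise fun k l ↦ ⟪Ψ (S k), Ψ (S l)⟫_ℝ = 0 := by
    intro k l hkl
    rcases hkl.lt_or_gt with h | h
    · exact horth l _ (hmem h)
    · rw [real_inner_comm]
      exact horth k _ (hmem h)
  have hcross_lt : ∀ {k l}, k < l → ⟪Φ (S k), Ψ (S l)⟫_ℝ = 0 := fun {k l} h ↦ by
    rw [hcross l _ (by simpa using h.le), coeff_eq_zero_of_natDegree_lt (by simpa using h),
      zero_mul]
  refine ⟨S, (hmonic 0).natDegree_eq_zero.1 (S.natDegree_eq 0), ⟨?_, hright, ?_⟩, fun k ↦ ?_⟩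
  · exact fun k l hkl ↦ (hself _ _).trans (hright hkl)
  · intro k l hkl
    rcases hkl.lt_or_gt with h | h
    · exact hcross_lt h
    · rw [hsymm]
      exact hcross_lt h
  · have hnorm : ‖Φ (S k)‖ = ‖Ψ (S k)‖ := by
      rw [norm_eq_sqrt_real_inner, norm_eq_sqrt_real_inner, hself]
    have hcoeff : (S k).coeff k = 1 := by simpa using (hmonic k).coeff_natDegree
    rw [hcross k _ (S.natDegree_eq k).le, hcoeff, hnorm, one_mul, Real.norm_eq_abs, abs_mul,
      abs_of_nonneg (sq_nonneg ‖Ψ (S k)‖), sq]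

end PolynomialRegression

section MaximalCorrelation

open scoped InnerProductSpace

variable {Ω : Type*}

/-- The Hirschfeld–Gebelein–Rényi maximal correlation of the σ-algebras `m₁` and `m₂` is at most
`κ`. Only `g` is required to be centred: for such `g`, centring `h` as well does not change the
left-hand side. -/
def MaximalCorrelationLE (m₁ m₂ : MeasurableSpace Ω) {_ : MeasurableSpace Ω} (μ : Measure Ω)
    (κ : ℝ) : Prop :=
  ∀ g ∈ lpMeas ℂ ℂ m₁ 2 μ, ∀ h ∈ lpMeas ℂ ℂ m₂ 2 μ, ∫ x, g x ∂μ = 0 →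
    ‖⟪g, h⟫_ℂ‖ ≤ κ * (‖g‖ * ‖h‖)

namespace MaximalCorrelationLE

variable {m₁ m₂ m₀ : MeasurableSpace Ω} {μ : Measure Ω} {κ : ℝ}

theorem norm_condExpL2_le (h : MaximalCorrelationLE m₁ m₂ μ κ) (hκ : 0 ≤ κ) (hm₂ : m₂ ≤ m₀)
    {g : Lp ℂ 2 μ} (hg : g ∈ lpMeas ℂ ℂ m₁ 2 μ) (hg₀ : ∫ x, g x ∂μ = 0) :
    ‖condExpL2 ℂ ℂ hm₂ g‖ ≤ κ * ‖g‖ := by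
  set u := condExpL2 ℂ ℂ hm₂ g
  have : Fact (m₂ ≤ m₀) := ⟨hm₂⟩
  have hu : condExpL2 ℂ ℂ hm₂ (u : Lp ℂ 2 μ) = u :=
    Submodule.orthogonalProjectionOnto_mem_subspace_eq_self u
  have hself : ⟪g, (u : Lp ℂ 2 μ)⟫_ℂ = ⟪(u : Lp ℂ 2 μ), (u : Lp ℂ 2 μ)⟫_ℂ := by
    conv_lhs => rw [← hu, ← inner_condExpL2_left_eq_right]
  have hle := h g hg u u.2 hg₀
  rw [hself, ← inner_self_re_eq_norm, inner_self_eq_norm_mul_norm, ← mul_assoc] at hle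
  rcases (norm_nonneg (u : Lp ℂ 2 μ)).eq_or_lt with hu₀ | hu₀
  · rw [Submodule.norm_coe] at hu₀
    rw [← hu₀]
    positivity
  · exact le_of_mul_le_mul_right hle hu₀

theorem eLpNorm_condExp_le [IsFiniteMeasure μ] (h : MaximalCorrelationLE m₁ m₂ μ κ) (hκ : 0 ≤ κ)
    (hm₂ : m₂ ≤ m₀) {g : Ω → ℂ} (hg : MemLp g 2 μ) (hgm : AEStronglyMeasurable[m₁] g μ)
    (hg₀ : ∫ x, g x ∂μ = 0) :
    eLpNorm (μ[g | m₂]) 2 μ ≤ ENNReal.ofReal κ * eLpNorm g 2 μ := by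
  have hmem : hg.toLp ∈ lpMeas ℂ ℂ m₁ 2 μ :=
    mem_lpMeas_iff_aestronglyMeasurable.2 (hgm.congr hg.coeFn_toLp.symm)
  have hle := h.norm_condExpL2_le hκ hm₂ hmem ((integral_congr_ae hg.coeFn_toLp).trans hg₀)
  calc eLpNorm (μ[g | m₂]) 2 μ
      = eLpNorm (condExpL2 ℂ ℂ hm₂ hg.toLp : Ω → ℂ) 2 μ :=
        (eLpNorm_congr_ae (hg.condExpL2_ae_eq_condExp hm₂)).symm
    _ = ENNReal.ofReal ‖condExpL2 ℂ ℂ hm₂ hg.toLp‖ := by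
        rw [← Lp.enorm_def, ← ofReal_norm, Submodule.norm_coe]
    _ ≤ ENNReal.ofReal (κ * ‖hg.toLp‖) := ENNReal.ofReal_le_ofReal hle
    _ = ENNReal.ofReal κ * eLpNorm g 2 μ := by
        rw [ENNReal.ofReal_mul hκ, ofReal_norm, Lp.enorm_toLp]

theorem eLpNorm_condExp_condExp_le [IsFiniteMeasure μ] (h : MaximalCorrelationLE m₁ m₂ μ κ)
    (hκ : 0 ≤ κ) (hm₁ : m₁ ≤ m₀) (hm₂ : m₂ ≤ m₀) {f : Ω → ℂ} (hf : MemLp f 2 μ)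
    (hf₀ : ∫ x, f x ∂μ = 0) :
    eLpNorm (μ[μ[f | m₁] | m₂]) 2 μ ≤ ENNReal.ofReal κ * eLpNorm f 2 μ :=
  calc eLpNorm (μ[μ[f | m₁] | m₂]) 2 μ
      ≤ ENNReal.ofReal κ * eLpNorm (μ[f | m₁]) 2 μ :=
        h.eLpNorm_condExp_le hκ hm₂ (hf.condExp one_le_two)
          stronglyMeasurable_condExp.aestronglyMeasurable (by rwa [integral_condExp hm₁])
    _ ≤ ENNReal.ofReal κ * eLpNorm f 2 μ := by
        gcongr
        exact eLpNorm_condExp_le_eLpNorm f one_le_two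

end MaximalCorrelationLE

end MaximalCorrelation

section PullbackLp

open scoped InnerProductSpace

theorem lpMeas_comap_subset_range_compMeasurePreserving {𝕜 Ω K F : Type*} [RCLike 𝕜]
    [MeasurableSpace Ω] [MeasurableSpace K] [NormedAddCommGroup F] [NormedSpace 𝕜 F]
    [CompleteSpace F] {p : ℝ≥0∞} {μ : Measure Ω} {Z : Ω → K} (hZ : Measurable Z) :
    (lpMeas F 𝕜 (MeasurableSpace.comap Z inferInstance) p μ : Set (Lp F p μ)) ⊆
      Set.range (Lp.compMeasurePreserving Z (hZ.measurePreserving μ)) := by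
  intro g hg
  obtain ⟨g', hg', hgg'⟩ := mem_lpMeas_iff_aestronglyMeasurable.1 hg
  obtain ⟨φ, hφ, rfl⟩ := hg'.exists_eq_measurable_comp
  have hφp : MemLp φ p (μ.map Z) := by
    rw [memLp_map_measure_iff hφ.aestronglyMeasurable hZ.aemeasurable]
    exact (memLp_congr_ae hgg').1 (Lp.memLp g)
  refine ⟨hφp.toLp, ?_⟩
  rw [Lp.toLp_compMeasurePreserving]
  exact Lp.ext ((MemLp.coeFn_toLp _).trans hgg'.symm)

variable {Ω K : Type*} [TopologicalSpace Ω] [CompactSpace Ω] [MeasurableSpace Ω] [BorelSpace Ω]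
  [TopologicalSpace K] (𝕜 : Type*) [RCLike 𝕜] (μ : Measure Ω) [IsFiniteMeasure μ]

/-- The linear map `u ↦ u ∘ Z` from continuous functions on `K` to `L²(μ)`. -/
noncomputable def pullbackLp (Z : C(Ω, K)) : C(K, 𝕜) →ₗ[𝕜] Lp 𝕜 2 μ :=
  (ContinuousMap.toLp 2 μ 𝕜).toLinearMap ∘ₗ (ContinuousMap.compRightAlgHom 𝕜 𝕜 Z).toLinearMap

theorem coeFn_pullbackLp (Z : C(Ω, K)) (u : C(K, 𝕜)) : pullbackLp 𝕜 μ Z u =ᵐ[μ] u ∘ Z :=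
  ContinuousMap.coeFn_toLp μ _

theorem inner_pullbackLp (Z Z' : C(Ω, K)) (u v : C(K, 𝕜)) :
    ⟪pullbackLp 𝕜 μ Z u, pullbackLp 𝕜 μ Z' v⟫_𝕜 =
      ∫ x, v (Z' x) * starRingEnd 𝕜 (u (Z x)) ∂μ :=
  ContinuousMap.inner_toLp μ _ _

variable [CompactSpace K] [MeasurableSpace K] [BorelSpace K]

theorem compMeasurePreserving_toLp (Z : C(Ω, K)) (u : C(K, 𝕜)) :
    Lp.compMeasurePreserving Z (Z.continuous.measurable.measurePreserving μ)
      (ContinuousMap.toLp 2 (μ.map Z) 𝕜 u) = pullbackLp 𝕜 μ Z u := by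
  have hZ := Z.continuous.measurable.measurePreserving μ
  refine Lp.ext ((Lp.coeFn_compMeasurePreserving _ hZ).trans ?_)
  exact (hZ.quasiMeasurePreserving.ae_eq_comp (ContinuousMap.coeFn_toLp _ u)).trans
    (coeFn_pullbackLp 𝕜 μ Z u).symm

theorem lpMeas_comap_le_topologicalClosure_map_pullbackLp [TopologicalSpace.MetrizableSpace K]
    (Z : C(Ω, K)) {S : Submodule 𝕜 C(K, 𝕜)} (hS : S.topologicalClosure = ⊤) :
    lpMeas 𝕜 𝕜 (MeasurableSpace.comap Z inferInstance) 2 μ ≤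
      (S.map (pullbackLp 𝕜 μ Z)).topologicalClosure := by
  intro g hg
  obtain ⟨φ, rfl⟩ := lpMeas_comap_subset_range_compMeasurePreserving
    Z.continuous.measurable hg
  have hφ : φ ∈ (S.map (ContinuousMap.toLp 2 (μ.map Z) 𝕜).toLinearMap).topologicalClosure := by
    have hdense := ContinuousMap.toLp_denseRange 𝕜 (μ.map Z) 𝕜 (p := 2) ENNReal.ofNat_ne_top
    rw [hdense.topologicalClosure_map_submodule hS]
    trivial
  refine map_mem_closure (Lp.isometry_compMeasurePreserving _).continuous hφ ?_
  rintro _ ⟨u, hu, rfl⟩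
  exact ⟨u, hu, (compMeasurePreserving_toLp 𝕜 μ Z u).symm⟩

end PullbackLp

section ProductPolynomials

open Polynomial

variable {ι : Type*} (K : Set ℝ)

/-- The `t`-th coordinate function on `K ^ ι`, as a complex-valued function. -/
noncomputable def coordFunction (t : ι) : C(ι → K, ℂ) where
  toFun y := ((y t : ℝ) : ℂ)
  continuous_toFun := by fun_prop

theorem star_coordFunction (t : ι) : star (coordFunction K t) = coordFunction K t := by
  ext y
  simp [coordFunction]

theorem adjoin_coordFunction_topologicalClosure [CompactSpace K] :
    (StarAlgebra.adjoin ℂ (Set.range (coordFunction (ι := ι) K))).topologicalClosure = ⊤ := by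
  refine ContinuousMap.starSubalgebra_topologicalClosure_eq_top_of_separatesPoints _ ?_
  intro x y hxy
  obtain ⟨t, ht⟩ := Function.ne_iff.1 hxy
  refine ⟨_, ⟨coordFunction K t, StarAlgebra.subset_adjoin ℂ _ ⟨t, rfl⟩, rfl⟩, ?_⟩
  simpa [coordFunction, Subtype.ext_iff] using ht

variable [Fintype ι]

/-- The function `y ↦ ∏ t, (p t) (y t)` on the power `K ^ ι` of a set of reals, for a family `p` of
real polynomials. It is complex valued, so that its multiples lie in the complex space `L²`. -/
noncomputable def prodPolynomial (p : ι → ℝ[X]) : C(ι → K, ℂ) where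
  toFun y := ∏ t, (((p t).eval (y t : ℝ) : ℝ) : ℂ)
  continuous_toFun := by fun_prop

theorem prodPolynomial_mem_span {S : ℕ → ℝ[X]} (hS : Submodule.span ℝ (Set.range S) = ⊤)
    (p : ι → ℝ[X]) :
    prodPolynomial K p ∈
      Submodule.span ℂ (Set.range fun α : ι → ℕ ↦ prodPolynomial K fun t ↦ S (α t)) := by
  classical
  choose x hx using fun t ↦ Finsupp.mem_span_range_iff_exists_finsupp.1 (hS ▸ Submodule.mem_top :
    p t ∈ Submodule.span ℝ (Set.range S))
  have hexpand : prodPolynomial K p = ∑ α ∈ Fintype.piFinset fun t ↦ (x t).support,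
      (∏ t, (x t (α t) : ℂ)) • prodPolynomial K fun t ↦ S (α t) := by
    ext y
    simp only [prodPolynomial, ContinuousMap.coe_mk, ContinuousMap.coe_sum, Finset.sum_apply,
      ContinuousMap.coe_smul, Pi.smul_apply, smul_eq_mul, ← Finset.prod_mul_distrib]
    rw [← Finset.prod_univ_sum (fun t ↦ (x t).support)
      (fun t k ↦ (x t k : ℂ) * (((S k).eval (y t : ℝ) : ℝ) : ℂ))]
    refine Finset.prod_congr rfl fun t _ ↦ ?_
    rw [← hx t, Finsupp.sum, eval_finsetSum, Complex.ofReal_sum]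
    simp only [eval_smul, smul_eq_mul, Complex.ofReal_mul]
  rw [hexpand]
  exact Submodule.sum_mem _ fun α _ ↦ Submodule.smul_mem _ _ (Submodule.subset_span ⟨α, rfl⟩)

theorem exists_eq_prodPolynomial_of_mem_closure_coordFunction {u : C(ι → K, ℂ)}
    (hu : u ∈ Submonoid.closure (Set.range (coordFunction (ι := ι) K))) :
    ∃ β : ι → ℕ, u = prodPolynomial K fun t ↦ X ^ β t := by
  classical
  induction hu using Submonoid.closure_induction with
  | mem u hu =>
    obtain ⟨t, rfl⟩ := hu
    refine ⟨Pi.single t 1, ?_⟩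
    ext y
    simp only [prodPolynomial, coordFunction, ContinuousMap.coe_mk]
    rw [Finset.prod_eq_single t] <;> simp +contextual
  | one => exact ⟨0, by ext y; simp [prodPolynomial]⟩
  | mul u v _ _ hu hv =>
    obtain ⟨β, rfl⟩ := hu
    obtain ⟨γ, rfl⟩ := hv
    exact ⟨β + γ, by ext y; simp [prodPolynomial, pow_add, Finset.prod_mul_distrib]⟩

theorem adjoin_coordFunction_le_span {S : ℕ → ℝ[X]} (hS : Submodule.span ℝ (Set.range S) = ⊤) :
    (StarAlgebra.adjoin ℂ (Set.range (coordFunction (ι := ι) K))).toSubalgebra.toSubmodule ≤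
      Submodule.span ℂ (Set.range fun α : ι → ℕ ↦ prodPolynomial K fun t ↦ S (α t)) := by
  have hstar : star (Set.range (coordFunction (ι := ι) K)) = Set.range (coordFunction K) := by
    rw [← Set.image_star, ← Set.range_comp]
    exact congrArg Set.range (funext (star_coordFunction K))
  rw [StarAlgebra.adjoin_toSubalgebra, hstar, Set.union_self, Algebra.adjoin_eq_span,
    Submodule.span_le]
  intro u hu
  obtain ⟨β, rfl⟩ := exists_eq_prodPolynomial_of_mem_closure_coordFunction K hu
  exact prodPolynomial_mem_span K hS _

theorem span_prodPolynomial_topologicalClosure [CompactSpace K] {S : ℕ → ℝ[X]}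
    (hS : Submodule.span ℝ (Set.range S) = ⊤) :
    (Submodule.span ℂ (Set.range fun α : ι → ℕ ↦
      prodPolynomial K fun t ↦ S (α t))).topologicalClosure = ⊤ := by
  rw [eq_top_iff]
  intro u _
  have hu : u ∈ (StarAlgebra.adjoin ℂ
      (Set.range (coordFunction (ι := ι) K))).topologicalClosure := by
    rw [adjoin_coordFunction_topologicalClosure]
    trivial
  exact closure_mono (adjoin_coordFunction_le_span K hS) hu

end ProductPolynomials

section IndependentCopies

open Polynomial ProbabilityTheory
open scoped InnerProductSpace

section ProductFamilies

variable {ι κ H H' : Type*} [Fintype ι] [NormedAddCommGroup H] [InnerProductSpace ℝ H]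
  [NormedAddCommGroup H'] [InnerProductSpace ℂ H']

theorem norm_eq_prod_norm_of_inner_eq_prod {e : ι → H} {E : H'}
    (hE : ⟪E, E⟫_ℂ = ((∏ t, ⟪e t, e t⟫_ℝ : ℝ) : ℂ)) : ‖E‖ = ∏ t, ‖e t‖ := by
  rw [← sq_eq_sq₀ (norm_nonneg _) (Finset.prod_nonneg fun _ _ ↦ norm_nonneg _),
    ← Finset.prod_pow, ← inner_self_eq_norm_sq (𝕜 := ℂ), hE]
  simp only [real_inner_self_eq_norm_sq, RCLike.re_to_complex, Complex.ofReal_re]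

theorem IsBiorthogonal.of_inner_eq_prod {e e' : κ → H} {E E' : (ι → κ) → H'}
    (h : IsBiorthogonal ℝ e e')
    (hleft : ∀ α β, ⟪E α, E β⟫_ℂ = ((∏ t, ⟪e (α t), e (β t)⟫_ℝ : ℝ) : ℂ))
    (hright : ∀ α β, ⟪E' α, E' β⟫_ℂ = ((∏ t, ⟪e' (α t), e' (β t)⟫_ℝ : ℝ) : ℂ))
    (hcross : ∀ α β, ⟪E α, E' β⟫_ℂ = ((∏ t, ⟪e (α t), e' (β t)⟫_ℝ : ℝ) : ℂ)) :
    IsBiorthogonal ℂ E E' := by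
  have hprod : ∀ {u : κ → κ → ℝ}, (Pairwise fun a b ↦ u a b = 0) →
      ∀ {α β : ι → κ}, α ≠ β → ((∏ t, u (α t) (β t) : ℝ) : ℂ) = 0 := by
    intro u hu α β hαβ
    obtain ⟨t, ht⟩ := Function.ne_iff.1 hαβ
    rw [Finset.prod_eq_zero (Finset.mem_univ t) (hu ht), Complex.ofReal_zero]
  exact ⟨fun α β hαβ ↦ (hleft α β).trans (hprod h.left hαβ),
    fun α β hαβ ↦ (hright α β).trans (hprod h.right hαβ),
    fun α β hαβ ↦ (hcross α β).trans (hprod h.cross hαβ)⟩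

theorem norm_inner_le_of_inner_eq_prod {e e' : ι → H} {E E' : H'} {c : ℝ} {t₀ : ι}
    (hleft : ⟪E, E⟫_ℂ = ((∏ t, ⟪e t, e t⟫_ℝ : ℝ) : ℂ))
    (hright : ⟪E', E'⟫_ℂ = ((∏ t, ⟪e' t, e' t⟫_ℝ : ℝ) : ℂ))
    (hcross : ⟪E, E'⟫_ℂ = ((∏ t, ⟪e t, e' t⟫_ℝ : ℝ) : ℂ))
    (hc : ‖⟪e t₀, e' t₀⟫_ℝ‖ ≤ c * (‖e t₀‖ * ‖e' t₀‖)) :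
    ‖⟪E, E'⟫_ℂ‖ ≤ c * (‖E‖ * ‖E'‖) := by
  classical
  have ht₀ := Finset.mem_univ t₀
  calc ‖⟪E, E'⟫_ℂ‖
      = ‖⟪e t₀, e' t₀⟫_ℝ‖ * ∏ t ∈ Finset.univ.erase t₀, ‖⟪e t, e' t⟫_ℝ‖ := by
        rw [hcross, Complex.norm_real, norm_prod,
          Finset.mul_prod_erase _ (fun t ↦ ‖⟪e t, e' t⟫_ℝ‖) ht₀]
    _ ≤ c * (‖e t₀‖ * ‖e' t₀‖) * ∏ t ∈ Finset.univ.erase t₀, ‖e t‖ * ‖e' t‖ := by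
        gcongr with t
        · exact (norm_nonneg _).trans hc
        · exact norm_inner_le_norm _ _
    _ = c * ∏ t, ‖e t‖ * ‖e' t‖ := by
        rw [mul_assoc, Finset.mul_prod_erase _ (fun t ↦ ‖e t‖ * ‖e' t‖) ht₀]
    _ = c * (‖E‖ * ‖E'‖) := by
        rw [norm_eq_prod_norm_of_inner_eq_prod hleft, norm_eq_prod_norm_of_inner_eq_prod hright,
          Finset.prod_mul_distrib]

end ProductFamilies

variable {Ω : Type*} [TopologicalSpace Ω] [CompactSpace Ω] [MeasurableSpace Ω] [BorelSpace Ω]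
  (μ : Measure Ω) [IsProbabilityMeasure μ] {K : Set ℝ}

/-- The linear map `p ↦ p(Z)` from real polynomials to `L²(μ)`, for a random variable `Z`. -/
noncomputable def polynomialLp (Z : C(Ω, K)) : ℝ[X] →ₗ[ℝ] Lp ℝ 2 μ :=
  pullbackLp ℝ μ Z ∘ₗ (toContinuousMapOnAlgHom K).toLinearMap

theorem inner_polynomialLp (Z Z' : C(Ω, K)) (p q : ℝ[X]) :
    ⟪polynomialLp μ Z p, polynomialLp μ Z' q⟫_ℝ =
      ∫ ω, p.eval (Z ω : ℝ) * q.eval (Z' ω : ℝ) ∂μ := by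
  refine (inner_pullbackLp ℝ μ Z Z' _ _).trans (integral_congr_ae (.of_forall fun ω ↦ ?_))
  simp [mul_comm]

theorem inner_polynomialLp_of_identDistrib {Z Z' W W' : C(Ω, K)}
    (h : IdentDistrib (fun ω ↦ (Z ω, Z' ω)) (fun ω ↦ (W ω, W' ω)) μ μ) (p q : ℝ[X]) :
    ⟪polynomialLp μ Z p, polynomialLp μ Z' q⟫_ℝ = ⟪polynomialLp μ W p, polynomialLp μ W' q⟫_ℝ := by
  rw [inner_polynomialLp, inner_polynomialLp]
  exact (h.comp (u := fun z ↦ p.eval (z.1 : ℝ) * q.eval (z.2 : ℝ)) (by fun_prop)).integral_eq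

variable {ι : Type*} [Fintype ι] [SecondCountableTopology Ω]

/-- The product `∏ t, (p t)(Z (x t))`, an element of the complex space `L²` of the product space. -/
noncomputable def prodPolynomialLp (Z : C(Ω, K)) (p : ι → ℝ[X]) :
    Lp ℂ 2 (Measure.pi fun _ : ι ↦ μ) :=
  pullbackLp ℂ (Measure.pi fun _ ↦ μ) (ContinuousMap.piMap fun _ ↦ Z) (prodPolynomial K p)

theorem inner_prodPolynomialLp (Z Z' : C(Ω, K)) (p q : ι → ℝ[X]) :
    ⟪prodPolynomialLp μ Z p, prodPolynomialLp μ Z' q⟫_ℂ =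
      ((∏ t, ⟪polynomialLp μ Z (p t), polynomialLp μ Z' (q t)⟫_ℝ : ℝ) : ℂ) := by
  simp only [inner_polynomialLp]
  rw [prodPolynomialLp, prodPolynomialLp, inner_pullbackLp, ← integral_fintype_prod_eq_prod,
    ← integral_complex_ofReal]
  refine integral_congr_ae (.of_forall fun x ↦ ?_)
  simp [prodPolynomial, Finset.prod_mul_distrib, mul_comm]

theorem prodPolynomialLp_one (Z : C(Ω, K)) :
    prodPolynomialLp μ Z (fun _ : ι ↦ 1) =ᵐ[Measure.pi fun _ ↦ μ] 1 := by
  refine (coeFn_pullbackLp ℂ _ _ _).trans (.of_forall fun x ↦ ?_)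
  simp [prodPolynomial]

theorem inner_prodPolynomialLp_one (Z : C(Ω, K)) (g : Lp ℂ 2 (Measure.pi fun _ : ι ↦ μ)) :
    ⟪prodPolynomialLp μ Z (fun _ ↦ 1), g⟫_ℂ = ∫ x, g x ∂(Measure.pi fun _ ↦ μ) := by
  rw [L2.inner_def]
  refine integral_congr_ae ?_
  filter_upwards [prodPolynomialLp_one μ Z] with x hx
  simp [hx]

theorem lpMeas_le_span_prodPolynomialLp [CompactSpace K] (Z : C(Ω, K)) {S : ℕ → ℝ[X]}
    (hS : Submodule.span ℝ (Set.range S) = ⊤) :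
    lpMeas ℂ ℂ (MeasurableSpace.comap (fun (x : ι → Ω) t ↦ Z (x t)) inferInstance) 2
        (Measure.pi fun _ ↦ μ) ≤
      (Submodule.span ℂ (Set.range fun α : ι → ℕ ↦
        prodPolynomialLp μ Z fun t ↦ S (α t))).topologicalClosure := by
  have h := lpMeas_comap_le_topologicalClosure_map_pullbackLp ℂ (Measure.pi fun _ : ι ↦ μ)
    (ContinuousMap.piMap fun _ ↦ Z) (span_prodPolynomial_topologicalClosure K hS)
  rwa [Submodule.map_span, ← Set.range_comp] at h

/-- **Tensorisation**: the polynomials that diagonalise the correlation of `U` and `V` have products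
that diagonalise the correlation of independent copies, and a nonconstant product has at least one
nonconstant factor. -/
theorem maximalCorrelationLE_pi_of_hasRegressionCoeff [CompactSpace K] {U V : C(Ω, K)} {c : ℕ → ℝ}
    {κ : ℝ} (hUV : IdentDistrib (fun ω ↦ (U ω, V ω)) (fun ω ↦ (V ω, U ω)) μ μ)
    (hreg : ∀ k, HasRegressionCoeff (polynomialLp μ U) (polynomialLp μ V) k (c k))
    (hc : ∀ k ≠ 0, |c k| ≤ κ) (hκ : 0 ≤ κ) :
    MaximalCorrelationLE (MeasurableSpace.comap (fun (x : ι → Ω) t ↦ U (x t)) inferInstance)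
      (MeasurableSpace.comap (fun (x : ι → Ω) t ↦ V (x t)) inferInstance)
      (Measure.pi fun _ ↦ μ) κ := by
  have hself : ∀ p q, ⟪polynomialLp μ U p, polynomialLp μ U q⟫_ℝ =
      ⟪polynomialLp μ V p, polynomialLp μ V q⟫_ℝ :=
    inner_polynomialLp_of_identDistrib μ (hUV.comp (u := fun z ↦ (z.1, z.1)) (by fun_prop))
  have hsymm : ∀ p q, ⟪polynomialLp μ U p, polynomialLp μ V q⟫_ℝ =
      ⟪polynomialLp μ U q, polynomialLp μ V p⟫_ℝ := fun p q ↦ by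
    rw [inner_polynomialLp_of_identDistrib μ hUV, real_inner_comm]
  obtain ⟨S, hS₀, hbi, hnorm⟩ := exists_sequence_isBiorthogonal hself hsymm hreg
  have hspan : Submodule.span ℝ (Set.range S) = ⊤ :=
    S.span fun k ↦ (leadingCoeff_ne_zero.2 (S.ne_zero k)).isUnit
  have hprod : IsBiorthogonal ℂ (fun α : ι → ℕ ↦ prodPolynomialLp μ U fun t ↦ S (α t))
      (fun α ↦ prodPolynomialLp μ V fun t ↦ S (α t)) :=
    hbi.of_inner_eq_prod (fun _ _ ↦ inner_prodPolynomialLp _ _ _ _ _)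
      (fun _ _ ↦ inner_prodPolynomialLp _ _ _ _ _) fun _ _ ↦ inner_prodPolynomialLp _ _ _ _ _
  intro g hg h hh hg₀
  refine hprod.norm_inner_le_of_inner_eq_zero (a₀ := 0) ?_ ?_ hκ
    (lpMeas_le_span_prodPolynomialLp μ U hspan hg) (lpMeas_le_span_prodPolynomialLp μ V hspan hh) ?_
  · simp only [Pi.zero_apply, hS₀]
    exact Lp.ext ((prodPolynomialLp_one μ U).trans (prodPolynomialLp_one μ V).symm)
  · intro α hα
    obtain ⟨t₀, ht₀⟩ := Function.ne_iff.1 hα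
    refine norm_inner_le_of_inner_eq_prod (t₀ := t₀) (inner_prodPolynomialLp _ _ _ _ _)
      (inner_prodPolynomialLp _ _ _ _ _) (inner_prodPolynomialLp _ _ _ _ _) ?_
    rw [hnorm]
    gcongr
    exact hc _ ht₀
  · simp only [Pi.zero_apply, hS₀, inner_prodPolynomialLp_one, hg₀]

end IndependentCopies

section PolarCoordinates

variable {E : Type*} [NormedAddCommGroup E] [NormedSpace ℝ E] [FiniteDimensional ℝ E]
  [MeasurableSpace E] [BorelSpace E] (μ : Measure E)

theorem integral_mul_fun_norm_of_homogeneous [Nontrivial E] [μ.IsAddHaarMeasure] {F : E → ℝ}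
    {d : ℕ} (hF : ∀ r : ℝ, 0 < r → ∀ x, F (r • x) = r ^ d * F x) (g : ℝ → ℝ) :
    ∫ x, F x * g ‖x‖ ∂μ =
      (∫ x : Metric.sphere (0 : E) 1, F x ∂μ.toSphere) *
        ∫ r : Set.Ioi (0 : ℝ), (r : ℝ) ^ d * g r
          ∂(Measure.volumeIoiPow (Module.finrank ℝ E - 1)) := by
  have hpolar := μ.measurePreserving_homeomorphUnitSphereProd.integral_comp
    (Homeomorph.measurableEmbedding _) fun z : Metric.sphere (0 : E) 1 × Set.Ioi (0 : ℝ) ↦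
      F z.1 * ((z.2 : ℝ) ^ d * g z.2)
  have hcompl : ∫ x, F x * g ‖x‖ ∂μ =
      ∫ x : ({0}ᶜ : Set E), F x.1 * g ‖x.1‖ ∂(μ.comap Subtype.val) := by
    rw [integral_subtype_comap (measurableSet_singleton _).compl fun x ↦ F x * g ‖x‖,
      restrict_compl_singleton]
  rw [← integral_prod_mul, hcompl, ← hpolar]
  refine integral_congr_ae (.of_forall fun x ↦ ?_)
  have hx : 0 < ‖(x : E)‖ := norm_pos_iff.2 x.2
  have hFx := hF _ hx (‖(x : E)‖⁻¹ • (x : E))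
  rw [smul_inv_smul₀ hx.ne'] at hFx
  simp only [homeomorphUnitSphereProd_apply_fst_coe, homeomorphUnitSphereProd_apply_snd_coe, hFx]
  ring

theorem integral_norm_pow_mul_exp_neg_norm_sq_pos [Nontrivial E] [μ.IsAddHaarMeasure] (d : ℕ) :
    0 < ∫ x, ‖x‖ ^ d * Real.exp (-‖x‖ ^ 2) ∂μ := by
  have hradial : ∫ r in Set.Ioi (0 : ℝ), r ^ (Module.finrank ℝ E - 1) *
      (r ^ d * Real.exp (-r ^ 2)) =
      ∫ r in Set.Ioi (0 : ℝ), r ^ ((Module.finrank ℝ E - 1 + d : ℕ) : ℝ) *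
        Real.exp (-r ^ (2 : ℝ)) := by
    simp only [Real.rpow_natCast, Real.rpow_two, pow_add, mul_assoc]
  have hdim : 0 < Module.finrank ℝ E := Module.finrank_pos
  have hball : 0 < μ.real (Metric.ball 0 1) :=
    ENNReal.toReal_pos (Metric.measure_ball_pos μ 0 one_pos).ne' measure_ball_lt_top.ne
  have hexp : (-1 : ℝ) < (Module.finrank ℝ E - 1 + d : ℕ) :=
    neg_one_lt_zero.trans_le (Nat.cast_nonneg _)
  rw [integral_fun_norm_addHaar μ fun r ↦ r ^ d * Real.exp (-r ^ 2)]
  simp only [smul_eq_mul, nsmul_eq_mul]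
  rw [hradial, integral_rpow_mul_exp_neg_rpow two_pos hexp]
  have : 0 < Real.Gamma (((Module.finrank ℝ E - 1 + d : ℕ) + 1) / 2) :=
    Real.Gamma_pos_of_pos (by positivity)
  positivity

end PolarCoordinates

section UniformMeasure

open ProbabilityTheory
open scoped Pointwise

variable {m : ℕ}

theorem integral_sphereUniform (F : UnitSphere m → ℝ) :
    ∫ x, F x ∂(sphereUniform m) =
      ((volume : Measure (EuclideanSpace ℝ (Fin (m + 1)))).toSphere.real Set.univ)⁻¹ *
        ∫ x, F x ∂(volume : Measure (EuclideanSpace ℝ (Fin (m + 1)))).toSphere := by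
  rw [sphereUniform, integral_smul_measure, ENNReal.toReal_inv, smul_eq_mul, measureReal_def]

theorem integrable_sphereUniform_of_continuous {F : UnitSphere m → ℝ} (hF : Continuous F) :
    Integrable F (sphereUniform m) :=
  hF.integrable_of_hasCompactSupport (.of_compactSpace _)

theorem integral_gaussian_eq_integral_sphereUniform_mul {F : EuclideanSpace ℝ (Fin (m + 1)) → ℝ}
    {d : ℕ} (hF : ∀ r : ℝ, 0 < r → ∀ x, F (r • x) = r ^ d * F x) :
    ∫ x, F x * Real.exp (-‖x‖ ^ 2) =
      (∫ x : UnitSphere m, F x ∂(sphereUniform m)) *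
        ∫ x : EuclideanSpace ℝ (Fin (m + 1)), ‖x‖ ^ d * Real.exp (-‖x‖ ^ 2) := by
  have hnorm : ∀ r : ℝ, 0 < r → ∀ x : EuclideanSpace ℝ (Fin (m + 1)),
      ‖r • x‖ ^ d = r ^ d * ‖x‖ ^ d := fun r hr x ↦ by
    rw [norm_smul, Real.norm_of_nonneg hr.le, mul_pow]
  have hne : (volume : Measure (EuclideanSpace ℝ (Fin (m + 1)))).toSphere.real Set.univ ≠ 0 := by
    rw [Ne, measureReal_eq_zero_iff, Measure.measure_univ_eq_zero]
    exact Measure.toSphere_ne_zero _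
  rw [integral_mul_fun_norm_of_homogeneous volume hF fun r ↦ Real.exp (-r ^ 2),
    integral_mul_fun_norm_of_homogeneous volume hnorm fun r ↦ Real.exp (-r ^ 2),
    integral_sphereUniform]
  simp only [norm_eq_of_mem_sphere, one_pow, integral_const, smul_eq_mul, mul_one]
  field_simp

theorem identDistrib_sphereUniform
    (e : EuclideanSpace ℝ (Fin (m + 1)) ≃ₗᵢ[ℝ] EuclideanSpace ℝ (Fin (m + 1))) :
    IdentDistrib (fun x : UnitSphere m ↦ e x)
      (fun x : UnitSphere m ↦ (x : EuclideanSpace ℝ (Fin (m + 1))))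
      (sphereUniform m) (sphereUniform m) := by
  have hmeas : Measurable fun x : UnitSphere m ↦ e x := by fun_prop
  refine ⟨hmeas.aemeasurable, measurable_subtype_coe.aemeasurable, ?_⟩
  ext s hs
  have hsphere : Metric.sphere 0 1 ∩ e ⁻¹' s = e ⁻¹' (Metric.sphere 0 1 ∩ s) := by
    ext x
    simp
  have hcone : Set.Ioo (0 : ℝ) 1 • (e ⁻¹' (Metric.sphere 0 1 ∩ s)) =
      e ⁻¹' (Set.Ioo (0 : ℝ) 1 • (Metric.sphere 0 1 ∩ s)) := by
    ext x
    constructor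
    · rintro ⟨r, hr, y, hy, rfl⟩
      exact ⟨r, hr, e y, hy, (map_smul e r y).symm⟩
    · rintro ⟨r, hr, y, hy, hx⟩
      exact ⟨r, hr, e.symm y, by simpa using hy, e.injective (by simpa using hx)⟩
  have hpre : (fun x : UnitSphere m ↦ e x) ⁻¹' s = Subtype.val ⁻¹' (e ⁻¹' s) := rfl
  rw [Measure.map_apply hmeas hs, Measure.map_apply measurable_subtype_coe hs, sphereUniform,
    Measure.smul_apply, Measure.smul_apply, Measure.toSphere_apply' _ (hmeas hs),
    Measure.toSphere_apply' _ (measurable_subtype_coe hs), hpre, Subtype.image_preimage_coe,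
    Subtype.image_preimage_coe, hsphere, hcone,
    e.measurePreserving.measure_preimage_emb e.toHomeomorph.measurableEmbedding]

end UniformMeasure

section Slices

variable {m : ℕ}

/-- The vector obtained from `x` by deleting its `j`-th coordinate. -/
def removeCoord (j : Fin (m + 1)) (x : EuclideanSpace ℝ (Fin (m + 1))) : EuclideanSpace ℝ (Fin m) :=
  WithLp.toLp 2 (j.removeNth x.ofLp)

theorem removeCoord_apply (j : Fin (m + 1)) (x : EuclideanSpace ℝ (Fin (m + 1))) (i : Fin m) :
    removeCoord j x i = x (j.succAbove i) :=
  rfl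

theorem removeCoord_smul (j : Fin (m + 1)) (r : ℝ) (x : EuclideanSpace ℝ (Fin (m + 1))) :
    removeCoord j (r • x) = r • removeCoord j x :=
  rfl

theorem norm_sq_eq_sq_add_norm_removeCoord_sq (j : Fin (m + 1))
    (x : EuclideanSpace ℝ (Fin (m + 1))) : ‖x‖ ^ 2 = x j ^ 2 + ‖removeCoord j x‖ ^ 2 := by
  rw [EuclideanSpace.real_norm_sq_eq, EuclideanSpace.real_norm_sq_eq, Fin.sum_univ_succAbove _ j]
  rfl

theorem integral_gaussian_split (j : Fin (m + 1)) (f : ℝ → ℝ) (h : EuclideanSpace ℝ (Fin m) → ℝ) :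
    ∫ x : EuclideanSpace ℝ (Fin (m + 1)), f (x j) * h (removeCoord j x) * Real.exp (-‖x‖ ^ 2) =
      (∫ t, f t * Real.exp (-t ^ 2)) * ∫ y, h y * Real.exp (-‖y‖ ^ 2) := by
  rw [← integral_prod_mul,
    ← ((MeasurePreserving.id volume).prod
      (EuclideanSpace.volume_preserving_symm_measurableEquiv_toLp (Fin m)).symm).integral_comp
      ((MeasurableEquiv.refl ℝ).prodCongr
        (MeasurableEquiv.toLp 2 (Fin m → ℝ))).measurableEmbedding,
    ← Measure.volume_eq_prod,
    ← (volume_preserving_piFinSuccAbove (fun _ ↦ ℝ) j).integral_comp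
      (MeasurableEquiv.measurableEmbedding _),
    ← (EuclideanSpace.volume_preserving_symm_measurableEquiv_toLp
      (Fin (m + 1))).integral_comp (MeasurableEquiv.measurableEmbedding _)]
  refine integral_congr_ae (.of_forall fun x ↦ ?_)
  change f (x j) * h (removeCoord j x) * Real.exp (-‖x‖ ^ 2) =
    f (x j) * Real.exp (-x j ^ 2) * (h (removeCoord j x) * Real.exp (-‖removeCoord j x‖ ^ 2))
  rw [norm_sq_eq_sq_add_norm_removeCoord_sq j, neg_add, Real.exp_add]
  ring

/-- Both sides are computed by integrating against a Gaussian on `ℝ^(m+2)`, whose `j`-th coordinate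
is independent of the others. -/
theorem integral_sphereUniform_pow_mul_homogeneous (j : Fin (m + 2)) (l : ℕ) {d : ℕ}
    {h : EuclideanSpace ℝ (Fin (m + 1)) → ℝ}
    (hh : ∀ r : ℝ, 0 < r → ∀ y, h (r • y) = r ^ d * h y) :
    ∫ x : UnitSphere (m + 1), x.1 j ^ l * h (removeCoord j x) ∂(sphereUniform (m + 1)) =
      (∫ y : UnitSphere m, h y ∂(sphereUniform m)) *
        ∫ x : UnitSphere (m + 1), x.1 j ^ l * ‖removeCoord j x‖ ^ d ∂(sphereUniform (m + 1)) := by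
  set R : ℝ := ∫ x : EuclideanSpace ℝ (Fin (m + 2)), ‖x‖ ^ (l + d) * Real.exp (-‖x‖ ^ 2)
  have hR : R ≠ 0 := (integral_norm_pow_mul_exp_neg_norm_sq_pos volume (l + d)).ne'
  have hslice : ∀ g : EuclideanSpace ℝ (Fin (m + 1)) → ℝ,
      (∀ r : ℝ, 0 < r → ∀ y, g (r • y) = r ^ d * g y) →
      (∫ x : UnitSphere (m + 1), x.1 j ^ l * g (removeCoord j x) ∂(sphereUniform (m + 1))) * R =
        (∫ t : ℝ, t ^ l * Real.exp (-t ^ 2)) * ((∫ y : UnitSphere m, g y ∂(sphereUniform m)) *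
          ∫ y : EuclideanSpace ℝ (Fin (m + 1)), ‖y‖ ^ d * Real.exp (-‖y‖ ^ 2)) := by
    intro g hg
    have hF : ∀ r : ℝ, 0 < r → ∀ x : EuclideanSpace ℝ (Fin (m + 2)),
        (r • x) j ^ l * g (removeCoord j (r • x)) =
          r ^ (l + d) * (x j ^ l * g (removeCoord j x)) := fun r hr x ↦ by
      rw [removeCoord_smul, hg r hr, PiLp.smul_apply, smul_eq_mul]
      ring
    rw [← integral_gaussian_eq_integral_sphereUniform_mul
        (F := fun x ↦ x j ^ l * g (removeCoord j x)) hF,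
      ← integral_gaussian_eq_integral_sphereUniform_mul hg, integral_gaussian_split j (· ^ l)]
  have hnorm := hslice (fun y ↦ ‖y‖ ^ d) fun r hr y ↦ by
    rw [norm_smul, Real.norm_of_nonneg hr.le, mul_pow]
  simp only [norm_eq_of_mem_sphere, one_pow, integral_const, probReal_univ, smul_eq_mul,
    one_mul] at hnorm
  refine mul_right_cancel₀ hR ?_
  rw [hslice h hh, mul_assoc, hnorm]
  ring

end Slices

section Moments

open ProbabilityTheory

variable {m : ℕ}

namespace UnitSphere

/-- The `i`-th coordinate on the unit sphere, as a continuous function with compact range. -/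
def coord (i : Fin (m + 1)) : C(UnitSphere m, Set.Icc (-1 : ℝ) 1) where
  toFun x := ⟨x.1 i, abs_le.1 <| by
    simpa [norm_eq_of_mem_sphere] using PiLp.norm_apply_le x.1 i⟩

theorem coe_coord (i : Fin (m + 1)) (x : UnitSphere m) : (coord i x : ℝ) = x.1 i :=
  rfl

theorem norm_removeCoord_sq (j : Fin (m + 1)) (x : UnitSphere m) :
    ‖removeCoord j x.1‖ ^ 2 = 1 - (coord j x : ℝ) ^ 2 := by
  rw [coe_coord, eq_sub_iff_add_eq', ← norm_sq_eq_sq_add_norm_removeCoord_sq,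
    norm_eq_of_mem_sphere, one_pow]

theorem identDistrib_coord_swap (i j : Fin (m + 1)) :
    IdentDistrib (fun x : UnitSphere m ↦ (coord i x, coord j x)) (fun x ↦ (coord j x, coord i x))
      (sphereUniform m) (sphereUniform m) := by
  let proj : ℝ → Set.Icc (-1 : ℝ) 1 := Set.projIcc (-1) 1 (by norm_num)
  have hcoord : ∀ (i : Fin (m + 1)) (x : UnitSphere m), proj (x.1 i) = coord i x := fun i x ↦
    Set.projIcc_val _ (coord i x)
  have hproj : Measurable proj := continuous_projIcc.measurable
  have h := (identDistrib_sphereUniform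
    (LinearIsometryEquiv.piLpCongrLeft 2 ℝ ℝ (Equiv.swap i j))).comp
    (u := fun x : EuclideanSpace ℝ (Fin (m + 1)) ↦ (proj (x j), proj (x i))) (by fun_prop)
  simpa [Function.comp_def, LinearIsometryEquiv.piLpCongrLeft_apply, Equiv.piCongrLeft'_apply,
    hcoord] using h

theorem integral_coord_pow_of_odd (i : Fin (m + 1)) {k : ℕ} (hk : Odd k) :
    ∫ x, (coord i x : ℝ) ^ k ∂(sphereUniform m) = 0 := by
  have h := ((identDistrib_sphereUniform (.neg ℝ)).comp
    (u := fun x : EuclideanSpace ℝ (Fin (m + 1)) ↦ x i ^ k) (by fun_prop)).integral_eq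
  simp only [Function.comp_apply, LinearIsometryEquiv.coe_neg, PiLp.neg_apply, hk.neg_pow,
    integral_neg] at h
  exact self_eq_neg.1 h.symm

theorem integral_coord_sq (i : Fin (m + 1)) :
    ∫ x, (coord i x : ℝ) ^ 2 ∂(sphereUniform m) = 1 / (m + 1) := by
  have hswap : ∀ i', ∫ x, (coord i' x : ℝ) ^ 2 ∂(sphereUniform m) =
      ∫ x, (coord i x : ℝ) ^ 2 ∂(sphereUniform m) := fun i' ↦
    ((identDistrib_coord_swap i' i).comp (u := fun z : Set.Icc (-1 : ℝ) 1 × Set.Icc (-1 : ℝ) 1 ↦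
      (z.1 : ℝ) ^ 2) (by fun_prop)).integral_eq
  have hsum : ∑ i' : Fin (m + 1), ∫ x, (coord i' x : ℝ) ^ 2 ∂(sphereUniform m) = 1 := by
    rw [← integral_finsetSum _ fun i' _ ↦ integrable_sphereUniform_of_continuous (by fun_prop)]
    simp [coe_coord, ← EuclideanSpace.real_norm_sq_eq, norm_eq_of_mem_sphere]
  rw [Finset.sum_congr rfl fun i' _ ↦ hswap i'] at hsum
  simp only [Finset.sum_const, Finset.card_univ, Fintype.card_fin, nsmul_eq_mul, Nat.cast_add,
    Nat.cast_one] at hsum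
  field_simp
  linarith

theorem abs_integral_coord_pow_le (i : Fin (m + 1)) {k : ℕ} (hk : k ≠ 0) :
    |∫ x, (coord i x : ℝ) ^ k ∂(sphereUniform m)| ≤ 1 / (m + 1) := by
  rcases k.even_or_odd' with ⟨b, rfl | rfl⟩
  · have hb : 1 ≤ b := by omega
    rw [abs_of_nonneg (integral_nonneg fun x ↦ (even_two_mul b).pow_nonneg _),
      ← integral_coord_sq i]
    refine integral_mono (integrable_sphereUniform_of_continuous (by fun_prop))
      (integrable_sphereUniform_of_continuous (by fun_prop)) fun x ↦ ?_
    have hx : (coord i x : ℝ) ^ 2 ≤ 1 := (sq_le_one_iff_abs_le_one _).2 (abs_le.2 (coord i x).2)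
    calc (coord i x : ℝ) ^ (2 * b) = ((coord i x : ℝ) ^ 2) ^ b := pow_mul _ _ _
      _ ≤ (coord i x : ℝ) ^ 2 := pow_le_of_le_one (sq_nonneg _) hx (by omega)
  · rw [integral_coord_pow_of_odd i (odd_two_mul_add_one b), abs_zero]
    positivity

theorem integral_coord_succAbove_pow_mul_coord_pow (j : Fin (m + 2)) (i : Fin (m + 1)) (k l : ℕ) :
    ∫ x, (coord (j.succAbove i) x : ℝ) ^ k * (coord j x : ℝ) ^ l ∂(sphereUniform (m + 1)) =
      (∫ y, (coord i y : ℝ) ^ k ∂(sphereUniform m)) *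
        ∫ x, (1 - (coord j x : ℝ) ^ 2) ^ (k / 2) * (coord j x : ℝ) ^ l
          ∂(sphereUniform (m + 1)) := by
  have h := integral_sphereUniform_pow_mul_homogeneous j l (h := fun y ↦ y i ^ k) (d := k)
    fun r _ y ↦ by rw [PiLp.smul_apply, smul_eq_mul, mul_pow]
  simp only [removeCoord_apply, ← coe_coord] at h
  simp only [mul_comm _ ((coord j _ : ℝ) ^ l)]
  rw [h]
  rcases k.even_or_odd' with ⟨b, rfl | rfl⟩
  · simp [pow_mul, norm_removeCoord_sq]
  · rw [integral_coord_pow_of_odd i (odd_two_mul_add_one b), zero_mul, zero_mul]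

end UnitSphere

end Moments

section CoordinateCorrelation

open Polynomial ProbabilityTheory
open scoped InnerProductSpace

theorem natDegree_one_sub_X_sq_pow_le (b : ℕ) : ((1 - X ^ 2 : ℝ[X]) ^ b).natDegree ≤ 2 * b := by
  compute_degree
  omega

theorem coeff_one_sub_X_sq_pow (b : ℕ) : ((1 - X ^ 2 : ℝ[X]) ^ b).coeff (2 * b) = (-1) ^ b := by
  have hdeg : (1 - X ^ 2 : ℝ[X]).natDegree ≤ 2 := by compute_degree
  rw [mul_comm 2 b, coeff_pow_of_natDegree_le hdeg]
  simp [coeff_one]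

namespace UnitSphere

variable {m : ℕ}

theorem hasRegressionCoeff_coord (j : Fin (m + 2)) (i : Fin (m + 1)) (k : ℕ) :
    HasRegressionCoeff (polynomialLp (sphereUniform (m + 1)) (coord (j.succAbove i)))
      (polynomialLp (sphereUniform (m + 1)) (coord j)) k
      ((-1) ^ (k / 2) * ∫ y, (coord i y : ℝ) ^ k ∂(sphereUniform m)) := by
  set M : ℝ := ∫ y, (coord i y : ℝ) ^ k ∂(sphereUniform m) with hM
  refine ⟨M • (1 - X ^ 2) ^ (k / 2), ?_, ?_, fun q ↦ ?_⟩
  · exact (natDegree_smul_le _ _).trans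
      ((natDegree_one_sub_X_sq_pow_le _).trans (Nat.mul_div_le k 2))
  · rcases k.even_or_odd' with ⟨b, rfl | rfl⟩
    · rw [Nat.mul_div_cancel_left b two_pos, coeff_smul, coeff_one_sub_X_sq_pow, smul_eq_mul,
        mul_comm]
    · simp [hM, integral_coord_pow_of_odd i (odd_two_mul_add_one b)]
  · induction q using Polynomial.induction_on' with
    | add p q hp hq => rw [map_add, inner_add_right, inner_add_right, hp, hq]
    | monomial l a =>
      rw [← smul_X_eq_monomial, map_smul, real_inner_smul_right, real_inner_smul_right, map_smul,
        real_inner_smul_left, inner_polynomialLp, inner_polynomialLp]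
      simp only [eval_pow, eval_X, eval_sub, eval_one, M,
        integral_coord_succAbove_pow_mul_coord_pow]

theorem maximalCorrelationLE_coord {ι : Type*} [Fintype ι] {i j : Fin (m + 2)} (hij : i ≠ j) :
    MaximalCorrelationLE
      (MeasurableSpace.comap (fun (x : ι → UnitSphere (m + 1)) t ↦ coord i (x t)) inferInstance)
      (MeasurableSpace.comap (fun (x : ι → UnitSphere (m + 1)) t ↦ coord j (x t)) inferInstance)
      (Measure.pi fun _ ↦ sphereUniform (m + 1)) (1 / (m + 1)) := by
  obtain ⟨i, rfl⟩ := Fin.exists_succAbove_eq hij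
  refine maximalCorrelationLE_pi_of_hasRegressionCoeff _ (identDistrib_coord_swap _ _)
    (hasRegressionCoeff_coord j i) (fun k hk ↦ ?_) (by positivity)
  simpa [abs_mul] using abs_integral_coord_pow_le i hk

end UnitSphere

theorem heightSigma_eq_comap_coord (m n : ℕ) (i : Fin (m + 1)) :
    heightSigma m n i =
      MeasurableSpace.comap (fun (x : Fin n → UnitSphere m) t ↦ UnitSphere.coord i (x t))
        inferInstance := by
  simp only [heightSigma, MeasurableSpace.pi, MeasurableSpace.comap_iSup,
    MeasurableSpace.comap_comp, Subtype.instMeasurableSpace]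
  rfl

end CoordinateCorrelation

theorem mainTheorem8_general {m n : ℕ} {i j : Fin (m + 1)} (hij : i ≠ j)
    (f : (Fin n → UnitSphere m) → ℂ)
    (hf : MemLp f 2 (spherePowUniform m n))
    (hf0 : ∫ x, f x ∂(spherePowUniform m n) = 0) :
    eLpNorm (heightCondExp m n j (heightCondExp m n i f)) 2 (spherePowUniform m n) ≤
      ENNReal.ofReal (1 / (m : ℝ)) * eLpNorm f 2 (spherePowUniform m n) := by
  cases m with
  | zero => exact absurd (Subsingleton.elim (α := Fin 1) i j) hij
  | succ m =>
    have hcorr : MaximalCorrelationLE (heightSigma (m + 1) n i) (heightSigma (m + 1) n j)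
        (spherePowUniform (m + 1) n) (1 / ((m + 1 : ℕ) : ℝ)) := by
      rw [heightSigma_eq_comap_coord, heightSigma_eq_comap_coord, Nat.cast_succ]
      exact UnitSphere.maximalCorrelationLE_coord hij
    exact hcorr.eLpNorm_condExp_condExp_le (by positivity) (heightSigma_le _ _ _)
      (heightSigma_le _ _ _) hf hf0

theorem mainTheorem8 (m n : ℕ) (hm : 2 ≤ m) (hn : 1 ≤ n)
    (f : (Fin n → UnitSphere m) → ℂ)
    (hf : MemLp f 2 (spherePowUniform m n))
    (hf0 : ∫ x, f x ∂(spherePowUniform m n) = 0) :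
    eLpNorm (heightCondExp m n 1 (heightCondExp m n 0 f)) 2 (spherePowUniform m n) ≤
      ENNReal.ofReal (1 / (m : ℝ)) * eLpNorm f 2 (spherePowUniform m n) := by
  obtain ⟨k, rfl⟩ := Nat.exists_eq_add_of_le' (Nat.one_le_of_lt hm)
  exact mainTheorem8_general Fin.zero_ne_one f hf hf0
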